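/- Let $\mathbb D$ be the open unit disc and $\sigma$ the area measure on $\mathbb D$ normalized by $\sigma(\mathbb D)=1$. For $1<p<\infty$ the Bergman space $A^p$ consists of the analytic functions $f$ in $\mathbb D$ with $\|f\|_{A^p}=\left(\int_{\mathbb D}|f|^p\,d\sigma\right)^{1/p}<\infty$. For a function $k\in A^q$, $\frac1p+\frac1q=1$, that is not identically zero, let $\phi_k(f)=\int_{\mathbb D} f\,\overline{k}\,d\sigma$ for $f\in A^p$. A function $F\in A^p$ with $\|F\|_{A^p}=1$ is called an $A^p$ extremal function for the kernel $k$ if $$\operatorname{Re}\phi_k(F)=\sup_{\|g\|_{A^p}=1}\operatorname{Re}\phi_k(g)=\|\phi_k\|_{(A^p)^*}.$$ For $w\in\mathbb C\setminus\{0\}$ write $\operatorname{sgn} w=w/|w|$. **Theorem.** Let $N\ge 1$ be an integer, let $1<p<\infty$, let $b\in\mathbb C$ satisfy $$|b|\ge 1+\frac1{N+1}\left(1-\frac2p\right),$$ and define $$a=\frac{|b|+\sqrt{|b|^2-\frac4{N+1}\left(1-\frac2p\right)}}{2}\,\operatorname{sgn} b .$$ Then $z^N+a$ has an analytic logarithm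 in $\mathbb D$, and the function $$F(z)=\operatorname{sgn}\!\left(a^{1-2/p}\right)\frac{(z^N+a)^{2/p}}{\left(|a|^2+\frac1{N+1}\right)^{1/p}},\qquad z\in\mathbb D,$$ is the unique $A^p$ extremal function for the kernel $z^N+b$. Here the analytic branch of $(z^N+a)^{2/p}$ in $\mathbb D$ may be chosen arbitrarily, and the value of $a^{1-2/p}$ is chosen consistently with it: if $L$ is any analytic function in $\mathbb D$ with $e^{L(z)}=z^N+a$, then $(z^N+a)^{2/p}=e^{(2/p)L(z)}$ and $a^{1-2/p}=e^{(1-2/p)L(0)}$. -/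

import Mathlib

open MeasureTheory

noncomputable section

namespace Bergman

/-- The open unit disc, as a set of complex numbers. -/
def disc : Set ℂ := Metric.ball 0 1

/-- Normalized area measure on the unit disc: Lebesgue measure on the disc, divided by its
total mass there. -/
def area : Measure ℂ := (volume disc)⁻¹ • volume.restrict disc

/-- `f` belongs to the Bergman space `A^p`: it is analytic in the unit disc and `|f|^p` is
integrable over the disc. Only the values of `f` in the disc matter. -/
structure MemBergman (p : ℝ) (f : ℂ → ℂ) : Prop where
  analytic : DifferentiableOn ℂ f disc
  integrable : Integrable (fun z => ‖f z‖ ^ p) area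

/-- The norm of `A^p`. -/
def norm (p : ℝ) (f : ℂ → ℂ) : ℝ := (∫ z, ‖f z‖ ^ p ∂area) ^ (1 / p)

/-- The functional with kernel `k`, namely `f ↦ ∫ f * conj k`. -/
def functional (k f : ℂ → ℂ) : ℂ := ∫ z, f z * (starRingEnd ℂ) (k z) ∂area

/-- `F` is an extremal function in `A^p` for the kernel `k` (a function in `A^q`, where
`1/p + 1/q = 1`, that does not vanish identically): `F` has norm one and
`Re φ(F) = sup {Re φ(g) : ‖g‖ = 1} = ‖φ‖`, where `φ` is the functional on `A^p` with kernel `k`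
and `‖φ‖` is its operator norm, the least `C ≥ 0` with `|φ(g)| ≤ C ‖g‖` for all `g` in `A^p`. -/
structure IsExtremal (p : ℝ) (k F : ℂ → ℂ) : Prop where
  kernel_mem : MemBergman (Real.conjExponent p) k
  kernel_ne_zero : ∃ z ∈ disc, k z ≠ 0
  mem : MemBergman p F
  norm_eq_one : norm p F = 1
  re_eq_sup : IsLUB {r : ℝ | ∃ g : ℂ → ℂ, MemBergman p g ∧ norm p g = 1 ∧
    r = (functional k g).re} (functional k F).re
  re_eq_norm : IsLeast {C : ℝ | 0 ≤ C ∧ ∀ g : ℂ → ℂ, MemBergman p g →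
    ‖functional k g‖ ≤ C * norm p g} (functional k F).re

/-- The complex signum `z / |z|`, with `sgn 0 = 0`. -/
def sgn (z : ℂ) : ℂ := z / (‖z‖ : ℂ)

/-- `L` is an analytic branch of `log g` in the unit disc. -/
structure IsLogBranch (g L : ℂ → ℂ) : Prop where
  analytic : DifferentiableOn ℂ L disc
  exp_eq : ∀ z ∈ disc, Complex.exp (L z) = g z

/-- The value at `z` of the branch of `g ^ s` that belongs to a branch `L` of `log g`. -/
def branchPow (L : ℂ → ℂ) (s : ℝ) (z : ℂ) : ℂ := Complex.exp ((s : ℂ) * L z)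

end Bergman

end

/-! ### Normalized area measure and integration in polar coordinates. -/

namespace Bergman

open Real Set

/-! By the equality case of Hölder, a zero-free `F` of norm one is the unique extremal function once
`k` induces a positive multiple of `f ↦ ∫ f W`, where `W = |F|^(p-2) conj F`
(`isExtremal_of_functional_eq`).

For the stated `F`, up to a constant, `W = (z^N + a)^s conj (z^N + a)` with `s = 1 - 2/p`. Put `P w
= (w + a)^s`. On `|z| = ρ` one has `conj z^N = ρ^(2N) / z^N`, so `f W - P(0) f conj (z^N + b)`
agrees there with an analytic function whose mean is its value at `0`. Since `∫ 2ρ ρ^(2N) dρ =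
1/(N+1)` over `(0, 1)`, the area integral vanishes if `conj a + s / (a (N+1)) = conj b`
(`integral_mul_comp_pow`, `integral_mul_branchPow`). With `a = t sgn b` this is the quadratic `t +
c/t = |b|`, `c = s/(N+1)`; the bound on `|b|` makes its larger root at least `1`, so `z^N + a` has
no zero in the disc. The factor `sgn (a^s)` makes the multiple positive, and `∫ |z^N + a|^2`
supplies the normalization. -/

theorem volume_disc : volume disc = ENNReal.ofReal π := by
  rw [disc, Complex.volume_ball, ENNReal.ofReal_one, one_pow, one_mul, ENNReal.ofReal,
    Real.toNNReal_of_nonneg pi_pos.le]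
  rfl

theorem isOpen_disc : IsOpen disc := Metric.isOpen_ball

theorem mem_disc {z : ℂ} : z ∈ disc ↔ ‖z‖ < 1 := by simp [disc]

theorem zero_mem_disc : (0 : ℂ) ∈ disc := by simp [disc]

theorem area_eq : area = (ENNReal.ofReal π)⁻¹ • volume.restrict disc := by
  rw [area, volume_disc]

instance : IsProbabilityMeasure area := by
  refine ⟨?_⟩
  rw [area_eq]
  simp only [Measure.smul_apply, Measure.restrict_apply_univ, volume_disc, smul_eq_mul]
  exact ENNReal.inv_mul_cancel (by simpa using pi_pos) ENNReal.ofReal_ne_top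

theorem area_absolutelyContinuous : area ≪ volume.restrict disc := by
  rw [area_eq]; exact Measure.smul_absolutelyContinuous

theorem absolutelyContinuous_area : volume.restrict disc ≪ area := by
  rw [area_eq]
  exact Measure.absolutelyContinuous_smul (by simp)

theorem ae_mem_disc : ∀ᵐ z ∂area, z ∈ disc :=
  area_absolutelyContinuous.ae_le (ae_restrict_mem isOpen_disc.measurableSet)

theorem integrable_area_iff {E : Type*} [NormedAddCommGroup E] {u : ℂ → E} :
    Integrable u area ↔ IntegrableOn u disc := by
  rw [area_eq, integrable_smul_measure (by simp) (by simpa using pi_pos)]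
  rfl

theorem integral_area {E : Type*} [NormedAddCommGroup E] [NormedSpace ℝ E] (u : ℂ → E) :
    ∫ z, u z ∂area = π⁻¹ • ∫ z in disc, u z := by
  rw [area_eq, integral_smul_measure, ENNReal.toReal_inv, ENNReal.toReal_ofReal pi_pos.le]

theorem aestronglyMeasurable_of_continuousOn {E : Type*} [NormedAddCommGroup E]
    {u : ℂ → E} (hu : ContinuousOn u disc) : AEStronglyMeasurable u area :=
  (hu.aestronglyMeasurable isOpen_disc.measurableSet).mono_ac area_absolutelyContinuous

theorem integrable_of_continuousOn_of_bound {E : Type*} [NormedAddCommGroup E]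
    {u : ℂ → E} (hu : ContinuousOn u disc) (C : ℝ) (hC : ∀ z ∈ disc, ‖u z‖ ≤ C) :
    Integrable u area :=
  Integrable.of_bound (aestronglyMeasurable_of_continuousOn hu) C
    (ae_mem_disc.mono hC)

theorem eqOn_of_ae_eq {u v : ℂ → ℂ} (h : u =ᵐ[area] v) (hu : ContinuousOn u disc)
    (hv : ContinuousOn v disc) : EqOn u v disc :=
  Measure.eqOn_open_of_ae_eq (absolutelyContinuous_area.ae_le h) isOpen_disc hu hv

theorem circleAverage_of_differentiableOn {g : ℂ → ℂ} (hg : DifferentiableOn ℂ g disc) {ρ : ℝ}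
    (h0 : 0 < ρ) (h1 : ρ < 1) : circleAverage g 0 ρ = g 0 := by
  refine DiffContOnCl.circleAverage (hg.diffContOnCl_ball ?_)
  rw [abs_of_pos h0]
  exact Metric.closedBall_subset_ball h1

/-- Provides the joint integrability that Fubini requires in polar coordinates. -/
theorem integrableOn_polarCoord {f : ℂ → ℂ} (hf : Integrable f) :
    IntegrableOn (fun q : ℝ × ℝ => q.1 • f (Complex.polarCoord.symm q)) polarCoord.target := by
  have hf' : Integrable (fun q : ℝ × ℝ => f (Complex.measurableEquivRealProd.symm q)) :=
    Complex.volume_preserving_equiv_real_prod.symm.integrable_comp_of_integrable hf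
  have h := (integrableOn_image_iff_integrableOn_abs_det_fderiv_smul volume
    polarCoord.open_target.measurableSet
    (fun q _ => (hasFDerivAt_polarCoord_symm q).hasFDerivWithinAt) polarCoord.symm.injOn
    (fun q : ℝ × ℝ => f (Complex.measurableEquivRealProd.symm q))).1 hf'.integrableOn
  refine h.congr_fun (fun q hq => ?_) polarCoord.open_target.measurableSet
  rw [polarCoord_target] at hq
  have : 0 < q.1 := hq.1
  simp only [det_fderivPolarCoordSymm, abs_of_pos this]
  rfl

theorem integral_angle_eq_circleAverage (f : ℂ → ℂ) (ρ : ℝ) :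
    ∫ θ in Ioo (-π) π, f (Complex.polarCoord.symm (ρ, θ)) = (2 * π) • circleAverage f 0 ρ := by
  have hc : ∀ θ : ℝ, Complex.polarCoord.symm (ρ, θ) = circleMap 0 ρ θ := by
    intro θ
    simp [circleMap, Complex.exp_mul_I]
  have hper : Function.Periodic (fun θ => f (circleMap 0 ρ θ)) (2 * π) := fun θ => by
    simp only [periodic_circleMap 0 ρ θ]
  simp_rw [hc]
  rw [circleAverage, smul_smul, mul_inv_cancel₀ (by positivity), one_smul,
    ← integral_Ioc_eq_integral_Ioo, ← intervalIntegral.integral_of_le (by linarith [pi_pos])]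
  have := hper.intervalIntegral_add_eq (-π) 0
  rw [zero_add] at this
  rw [← this]
  congr 1
  ring

/-- The area integral as a radial integral of circle averages. -/
theorem integral_area_eq_radial {u : ℂ → ℂ} (hu : Integrable u area) {v : ℝ → ℂ}
    (hv : ∀ ρ, 0 < ρ → ρ < 1 → circleAverage u 0 ρ = v ρ) :
    ∫ z, u z ∂area = ∫ ρ in (0 : ℝ)..1, (2 * ρ : ℂ) * v ρ := by
  rw [integrable_area_iff] at hu
  have hf : Integrable (disc.indicator u) :=
    (integrable_indicator_iff isOpen_disc.measurableSet).2 hu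
  have hint := integrableOn_polarCoord hf
  rw [integral_area, ← integral_indicator isOpen_disc.measurableSet,
    ← Complex.integral_comp_polarCoord_symm]
  rw [polarCoord_target] at hint ⊢
  rw [Measure.volume_eq_prod] at hint ⊢
  rw [setIntegral_prod _ hint]
  have key : ∀ ρ ∈ Ioi (0 : ℝ), (∫ θ in Ioo (-π) π,
      ρ • disc.indicator u (Complex.polarCoord.symm (ρ, θ)))
      = (Ioo (0 : ℝ) 1).indicator (fun ρ : ℝ => (π : ℂ) * ((2 * ρ : ℂ) * v ρ)) ρ := by
    intro ρ hρ
    have hρ : 0 < ρ := hρ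
    have hn : ∀ θ : ℝ, ‖Complex.polarCoord.symm (ρ, θ)‖ = ρ := fun θ => by
      rw [Complex.norm_polarCoord_symm, abs_of_pos hρ]
    rw [integral_smul]
    by_cases h1 : ρ < 1
    · have : ∀ θ : ℝ, disc.indicator u (Complex.polarCoord.symm (ρ, θ))
          = u (Complex.polarCoord.symm (ρ, θ)) := fun θ =>
        indicator_of_mem (mem_disc.2 (by rw [hn]; exact h1)) _
      simp_rw [this]
      rw [integral_angle_eq_circleAverage, hv ρ hρ h1, indicator_of_mem (show ρ ∈ Ioo (0:ℝ) 1 from ⟨hρ, h1⟩)]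
      simp only [Complex.real_smul]
      push_cast
      ring
    · have : ∀ θ : ℝ, disc.indicator u (Complex.polarCoord.symm (ρ, θ)) = 0 := fun θ =>
        indicator_of_notMem (fun h => h1 (by simpa only [mem_disc, hn] using h)) _
      simp_rw [this]
      rw [indicator_of_notMem (fun h => h1 h.2)]
      simp
  rw [setIntegral_congr_fun measurableSet_Ioi key, integral_indicator measurableSet_Ioo,
    Measure.restrict_restrict measurableSet_Ioo,
    inter_eq_left.2 (Ioo_subset_Ioi_self), integral_const_mul, ← integral_Ioc_eq_integral_Ioo,
    ← intervalIntegral.integral_of_le zero_le_one, Complex.real_smul, ← mul_assoc]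
  push_cast
  rw [inv_mul_cancel₀ (by exact_mod_cast pi_ne_zero), one_mul]

/-- The radial integral of `A + B ρ ^ (2 N)`. -/
theorem integral_area_of_circleAverage {u : ℂ → ℂ} (hu : Integrable u area) {A B : ℂ} {N : ℕ}
    (hv : ∀ ρ : ℝ, 0 < ρ → ρ < 1 → circleAverage u 0 ρ = A + B * (ρ : ℂ) ^ (2 * N)) :
    ∫ z, u z ∂area = A + B / ((N : ℂ) + 1) := by
  rw [integral_area_eq_radial hu hv]
  have h : ∀ ρ : ℝ, (2 * ρ : ℂ) * (A + B * (ρ : ℂ) ^ (2 * N))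
      = (2 * A) * (ρ : ℂ) + (2 * B) * (ρ : ℂ) ^ (2 * N + 1) := fun ρ => by ring
  simp_rw [h]
  have hN : (N : ℂ) + 1 ≠ 0 := by exact_mod_cast N.succ_ne_zero
  have h1 : ∫ ρ in (0 : ℝ)..1, (ρ : ℂ) = 1 / 2 := by
    rw [intervalIntegral.integral_ofReal, integral_id]; norm_num
  have h2 : ∫ ρ in (0 : ℝ)..1, (ρ : ℂ) ^ (2 * N + 1) = 1 / (2 * ((N : ℂ) + 1)) := by
    have : ∀ ρ : ℝ, (ρ : ℂ) ^ (2 * N + 1) = ((ρ ^ (2 * N + 1) : ℝ) : ℂ) := fun ρ => by push_cast; rfl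
    simp_rw [this]
    rw [intervalIntegral.integral_ofReal, integral_pow]
    push_cast
    have h' : (2 * (N : ℂ) + 1 + 1) = 2 * ((N : ℂ) + 1) := by ring
    simp [h']
  rw [intervalIntegral.integral_add, intervalIntegral.integral_const_mul,
    intervalIntegral.integral_const_mul, h1, h2]
  · field_simp
  · exact (Continuous.intervalIntegrable (by fun_prop) _ _)
  · exact (Continuous.intervalIntegrable (by fun_prop) _ _)

end Bergman

/-! ### Hölder duality: a criterion for the unique extremal function. -/

namespace Bergman

open Real Set

variable {p K : ℝ} {k F W : ℂ → ℂ}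

theorem MemBergman.continuousOn {f : ℂ → ℂ} (hf : MemBergman p f) : ContinuousOn f disc :=
  hf.analytic.continuousOn

theorem memLp_of_continuousOn {f : ℂ → ℂ} (hp : 0 < p) (hf : ContinuousOn f disc)
    (hi : Integrable (fun z => ‖f z‖ ^ p) area) : MemLp f (ENNReal.ofReal p) area := by
  rw [← integrable_norm_rpow_iff (aestronglyMeasurable_of_continuousOn hf) (by simpa using hp)
    ENNReal.ofReal_ne_top, ENNReal.toReal_ofReal hp.le]
  exact hi

theorem memBergman_of_bound {f : ℂ → ℂ} (hp : 0 < p) (hf : DifferentiableOn ℂ f disc) (C : ℝ)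
    (hC : ∀ z ∈ disc, ‖f z‖ ≤ C) : MemBergman p f := by
  refine ⟨hf, integrable_of_continuousOn_of_bound
    (hf.continuousOn.norm.rpow_const fun _ _ => Or.inr hp.le) (C ^ p) fun z hz => ?_⟩
  rw [Real.norm_of_nonneg (by positivity)]
  exact rpow_le_rpow (norm_nonneg _) (hC z hz) hp.le

theorem MemBergman.integrable_mul_of_bound {f w : ℂ → ℂ} (hp : 1 < p) (hf : MemBergman p f)
    (hw : ContinuousOn w disc) (C : ℝ) (hC : ∀ z ∈ disc, ‖w z‖ ≤ C) :
    Integrable (fun z => f z * w z) area := by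
  have h1 : Integrable f area := (memLp_of_continuousOn (by linarith) hf.continuousOn
    hf.integrable).integrable (by simpa using hp.le)
  exact h1.mul_bdd (aestronglyMeasurable_of_continuousOn hw) (ae_mem_disc.mono hC)

theorem norm_eq_one_iff (hp : 1 < p) {f : ℂ → ℂ} :
    Bergman.norm p f = 1 ↔ ∫ z, ‖f z‖ ^ p ∂area = 1 := by
  have h0 : 0 ≤ ∫ z, ‖f z‖ ^ p ∂area := integral_nonneg fun z => by positivity
  rw [Bergman.norm, ← rpow_left_inj h0 zero_le_one (show 1 / p ≠ 0 by positivity), one_rpow]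

theorem rpow_sub_one_rpow_conjExponent (hp : 1 < p) {x : ℝ} (hx : 0 ≤ x) :
    (x ^ (p - 1)) ^ conjExponent p = x ^ p := by
  rw [← rpow_mul hx, conjExponent, mul_div_cancel₀ _ (by linarith)]

/-- A function `F` of norm one is the unique extremal function for `k` as soon as the functional
with kernel `k` is a positive multiple of `f ↦ ∫ f |F| ^ (p - 2) conj F`. -/
theorem isExtremal_of_functional_eq (hp : 1 < p) (hk : MemBergman (conjExponent p) k)
    (hk0 : ∃ z ∈ disc, k z ≠ 0) (hF : MemBergman p F) (hF1 : Bergman.norm p F = 1)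
    (hF0 : ∀ z ∈ disc, F z ≠ 0) (hW : ContinuousOn W disc)
    (hWn : ∀ z ∈ disc, ‖W z‖ = ‖F z‖ ^ (p - 1))
    (hFW : ∀ z ∈ disc, F z * W z = ((‖F z‖ ^ p : ℝ) : ℂ)) (hK : 0 < K)
    (hdual : ∀ f, MemBergman p f → functional k f = K * ∫ z, f z * W z ∂area) :
    IsExtremal p k F ∧ ∀ G, IsExtremal p k G → EqOn G F disc := by
  have hpq : p.HolderConjugate (conjExponent p) := .conjExponent hp
  have hFint := (norm_eq_one_iff hp).1 hF1
  have hWq : ∀ z ∈ disc, ‖W z‖ ^ conjExponent p = ‖F z‖ ^ p := fun z hz => by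
    rw [hWn z hz, rpow_sub_one_rpow_conjExponent hp (norm_nonneg _)]
  have hWae : (fun z => ‖F z‖ ^ p) =ᵐ[area] fun z => ‖W z‖ ^ conjExponent p :=
    ae_mem_disc.mono fun z hz => (hWq z hz).symm
  have hWi := hF.integrable.congr hWae
  have hWint : ∫ z, ‖W z‖ ^ conjExponent p ∂area = 1 := by
    rw [← integral_congr_ae hWae, hFint]
  have hWL := memLp_of_continuousOn hpq.symm.pos hW hWi
  have hle : ∀ f, MemBergman p f → ‖∫ z, f z * W z ∂area‖ ≤ Bergman.norm p f := by
    intro f hf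
    have h := integral_mul_norm_le_Lp_mul_Lq hpq
      (memLp_of_continuousOn hpq.pos hf.continuousOn hf.integrable) hWL
    rw [hWint, one_rpow, mul_one] at h
    refine (norm_integral_le_integral_norm _).trans ?_
    simpa only [norm_mul, Bergman.norm] using h
  have hval : functional k F = K := by
    rw [hdual F hF, integral_congr_ae (ae_mem_disc.mono hFW), integral_complex_ofReal, hFint]
    simp
  have hbound : ∀ g, MemBergman p g → ‖functional k g‖ ≤ K * Bergman.norm p g := by
    intro g hg
    rw [hdual g hg, norm_mul, Complex.norm_real, norm_of_nonneg hK.le]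
    exact mul_le_mul_of_nonneg_left (hle g hg) hK.le
  have hre : (functional k F).re = K := by rw [hval, Complex.ofReal_re]
  have hext : IsExtremal p k F := by
    refine ⟨hk, hk0, hF, hF1, ⟨?_, fun r hr => hr ⟨F, hF, hF1, rfl⟩⟩, ?_, ?_⟩
    · rintro r ⟨g, hg, hg1, rfl⟩
      have := hbound g hg
      rw [hg1, mul_one] at this
      rw [hre]
      exact (Complex.re_le_norm _).trans this
    · rw [hre]
      exact ⟨hK.le, hbound⟩
    · rintro C ⟨-, hC⟩
      have := hC F hF
      rw [hF1, mul_one] at this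
      exact (Complex.re_le_norm _).trans this
  refine ⟨hext, fun G hG => ?_⟩
  have hGre : (functional k G).re = K := by rw [← hre]; exact hG.re_eq_sup.unique hext.re_eq_sup
  have hGint := (norm_eq_one_iff hp).1 hG.norm_eq_one
  have hGW : (∫ z, (G z * W z).re ∂area) = 1 := by
    have hi : Integrable (fun z => G z * W z) area := by
      have := hpq.ennrealOfReal
      exact (memLp_of_continuousOn hpq.pos hG.mem.continuousOn hG.mem.integrable).integrable_mul hWL
    have h1 : (∫ z, (G z * W z).re ∂area) = (∫ z, G z * W z ∂area).re := integral_re hi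
    rw [hdual G hG.mem, Complex.re_ofReal_mul] at hGre
    rw [h1]
    exact mul_left_cancel₀ hK.ne' (by rw [hGre, mul_one])
  -- A non-integrable function would have integral `0` by convention, not `1`.
  have hGWi : Integrable (fun z => (G z * W z).re) area := by
    by_contra h
    rw [integral_undef h] at hGW
    exact zero_ne_one hGW
  have hyoung : ∀ z, (G z * W z).re ≤ ‖G z‖ * ‖W z‖ ∧
      ‖G z‖ * ‖W z‖ ≤ ‖G z‖ ^ p / p + ‖W z‖ ^ conjExponent p / conjExponent p := fun z =>
    ⟨norm_mul (G z) (W z) ▸ Complex.re_le_norm _,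
      young_inequality_of_nonneg (norm_nonneg _) (norm_nonneg _) hpq⟩
  have hi1 := hG.mem.integrable.div_const p
  have hi2 := hWi.div_const (conjExponent p)
  -- The Young defect is nonnegative with integral `1/p + 1/q - 1 = 0`, so equality holds almost
  -- everywhere.
  have hzero := (integral_eq_zero_iff_of_nonneg (μ := area)
    (f := fun z => ‖G z‖ ^ p / p + ‖W z‖ ^ conjExponent p / conjExponent p - (G z * W z).re)
    (fun z => sub_nonneg.2 ((hyoung z).1.trans (hyoung z).2)) ((hi1.add hi2).sub hGWi)).1 (by
      have e := integral_sub (hi1.add hi2) hGWi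
      simp only [Pi.add_apply] at e
      rw [e, integral_add hi1 hi2, integral_div, integral_div, hGint, hWint, hGW, one_div, one_div,
        hpq.inv_add_inv_eq_one, sub_self])
  refine eqOn_of_ae_eq ?_ hG.mem.continuousOn hF.continuousOn
  filter_upwards [hzero, ae_mem_disc] with z hz hzd
  obtain ⟨h1, h2⟩ := hyoung z
  have hz : ‖G z‖ ^ p / p + ‖W z‖ ^ conjExponent p / conjExponent p - (G z * W z).re = 0 := hz
  have e1 : (G z * W z).re = ‖G z * W z‖ := by rw [norm_mul]; linarith
  have e2 := (young_inequality_eq_iff_of_nonneg (norm_nonneg _) (norm_nonneg _) hpq).1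
    (show ‖G z‖ * ‖W z‖ = ‖G z‖ ^ p / p + ‖W z‖ ^ conjExponent p / conjExponent p by linarith)
  -- Equality fixes both argument and modulus: `G W` is real, nonnegative and equal to `|W|^q =
  -- |F|^p`.
  have hGWz : G z * W z = F z * W z := by
    have h3 : G z * W z = (‖G z * W z‖ : ℂ) :=
      Complex.eq_coe_norm_of_nonneg (Complex.re_eq_norm.1 e1)
    have h4 : ‖G z * W z‖ = ‖F z‖ ^ p := by
      have h5 : ‖G z‖ * ‖W z‖ = ‖W z‖ ^ conjExponent p * (p⁻¹ + (conjExponent p)⁻¹) := by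
        rw [e2] at hz h2
        rw [mul_add, ← div_eq_mul_inv, ← div_eq_mul_inv]
        linarith
      rw [norm_mul, ← hWq z hzd, h5, hpq.inv_add_inv_eq_one, mul_one]
    rw [h3, h4, hFW z hzd]
  have hWz : W z ≠ 0 := by
    rw [← norm_ne_zero_iff, hWn z hzd]
    exact (rpow_pos_of_pos (norm_pos_iff.2 (hF0 z hzd)) _).ne'
  exact mul_right_cancel₀ hWz hGWz

end Bergman

/-! ### Logarithms of `z^N + a` and the two explicit integrals. -/

namespace Bergman

open Real Set

variable {N : ℕ} {a b : ℂ} {L : ℂ → ℂ}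

theorem pow_mem_disc (hN : 1 ≤ N) {z : ℂ} (hz : z ∈ disc) : z ^ N ∈ disc := by
  rw [mem_disc] at hz ⊢
  rw [norm_pow]
  exact pow_lt_one₀ (norm_nonneg z) hz (by omega)

theorem ne_zero_of_one_le_norm (ha : 1 ≤ ‖a‖) : a ≠ 0 :=
  norm_pos_iff.1 (by linarith)

theorem one_add_div_mem_slitPlane (ha : 1 ≤ ‖a‖) {w : ℂ} (hw : w ∈ disc) :
    1 + w / a ∈ Complex.slitPlane := by
  refine Complex.mem_slitPlane_of_norm_lt_one ?_
  rw [mem_disc] at hw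
  rw [norm_div, div_lt_one (by linarith)]
  linarith

theorem differentiableOn_log_one_add_div (ha : 1 ≤ ‖a‖) :
    DifferentiableOn ℂ (fun w => Complex.log (1 + w / a)) disc := fun w hw => by
  have h : DifferentiableAt ℂ (fun w : ℂ => 1 + w / a) w := by fun_prop
  exact (h.clog (one_add_div_mem_slitPlane ha hw)).differentiableWithinAt

theorem isLogBranch_log (hN : 1 ≤ N) (ha : 1 ≤ ‖a‖) {c : ℂ} (hc : Complex.exp c = a) :
    IsLogBranch (fun z => z ^ N + a) (fun z => c + Complex.log (1 + z ^ N / a)) := by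
  have ha0 := ne_zero_of_one_le_norm ha
  refine ⟨((differentiableOn_log_one_add_div ha).comp (by fun_prop)
    (fun z hz => pow_mem_disc hN hz)).const_add c, fun z hz => ?_⟩
  rw [Complex.exp_add, hc, Complex.exp_log
    (Complex.slitPlane_ne_zero (one_add_div_mem_slitPlane ha (pow_mem_disc hN hz)))]
  field_simp
  ring

/-- The difference of two branches has exponential `1`; differentiating shows that it is constant on
the connected disc. -/
theorem IsLogBranch.eqOn {g M : ℂ → ℂ} (hL : IsLogBranch g L) (hM : IsLogBranch g M)
    (h0 : L 0 = M 0) : EqOn L M disc := by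
  have hd : DifferentiableOn ℂ (fun z => L z - M z) disc := hL.analytic.sub hM.analytic
  have he : ∀ z ∈ disc, Complex.exp (L z - M z) = 1 := fun z hz => by
    rw [Complex.exp_sub, hL.exp_eq z hz, ← hM.exp_eq z hz, div_self (Complex.exp_ne_zero _)]
  have hderiv : EqOn (deriv fun z => L z - M z) 0 disc := by
    intro z hz
    have h1 := ((hd.differentiableAt (isOpen_disc.mem_nhds hz)).hasDerivAt).cexp
    have h2 : HasDerivAt (fun z => Complex.exp (L z - M z)) 0 z :=
      (hasDerivAt_const z (1 : ℂ)).congr_of_eventuallyEq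
        (Filter.eventuallyEq_of_mem (isOpen_disc.mem_nhds hz) he)
    have h3 := h1.unique h2
    rw [he z hz, one_mul] at h3
    exact h3
  intro z hz
  have := isOpen_disc.is_const_of_deriv_eq_zero
    (convex_ball (0 : ℂ) 1).isPreconnected hd hderiv hz zero_mem_disc
  simp only [h0, sub_self] at this
  exact sub_eq_zero.1 this

/-- Shows that every branch depends on `z` through `z^N` only, so its powers have the form `P (z^N)`
with `P` analytic in the disc. -/
theorem IsLogBranch.eq_add_log (hN : 1 ≤ N) (ha : 1 ≤ ‖a‖)
    (hL : IsLogBranch (fun z => z ^ N + a) L) {z : ℂ} (hz : z ∈ disc) :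
    L z = L 0 + Complex.log (1 + z ^ N / a) := by
  have h0 : Complex.exp (L 0) = a := by
    rw [hL.exp_eq 0 zero_mem_disc, zero_pow (by omega), zero_add]
  refine hL.eqOn (isLogBranch_log hN ha h0) ?_ hz
  simp [zero_pow (show N ≠ 0 by omega)]

/-- On the circle of radius `ρ`, `conj z ^ N = ρ ^ (2 N) / z ^ N` turns the integrand into the
restriction of an analytic function. -/
theorem integral_mul_comp_pow {f P : ℂ → ℂ} (hN : 1 ≤ N) (hf : DifferentiableOn ℂ f disc)
    (hP : DifferentiableOn ℂ P disc)
    (hab : starRingEnd ℂ a * P 0 + deriv P 0 / ((N : ℂ) + 1) = P 0 * starRingEnd ℂ b)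
    (h1 : Integrable (fun z => f z * (P (z ^ N) * starRingEnd ℂ (z ^ N + a))) area)
    (h2 : Integrable (fun z => f z * starRingEnd ℂ (z ^ N + b)) area) :
    ∫ z, f z * (P (z ^ N) * starRingEnd ℂ (z ^ N + a)) ∂area
      = P 0 * ∫ z, f z * starRingEnd ℂ (z ^ N + b) ∂area := by
  have hmaps : MapsTo (fun z : ℂ => z ^ N) disc disc := fun z hz => pow_mem_disc hN hz
  have hPN : DifferentiableOn ℂ (fun z => P (z ^ N)) disc := hP.comp (by fun_prop) hmaps
  have hQN : DifferentiableOn ℂ (fun z => dslope P 0 (z ^ N)) disc :=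
    ((Complex.differentiableOn_dslope (isOpen_disc.mem_nhds zero_mem_disc)).2 hP).comp
      (by fun_prop) hmaps
  rw [← sub_eq_zero, ← integral_const_mul, ← integral_sub h1 (h2.const_mul _)]
  refine (integral_area_of_circleAverage (h1.sub (h2.const_mul (P 0))) (N := N)
    (A := f 0 * (starRingEnd ℂ a * P 0 - P 0 * starRingEnd ℂ b)) (B := f 0 * deriv P 0) ?_).trans ?_
  rotate_left
  · linear_combination f 0 * hab
  · intro ρ h0 hlt
    -- Subtracting `P 0` makes the coefficient of `conj z^N` divisible by `z^N`; the quotient is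
    -- `dslope P 0 (z^N)`, with value `P'(0)` at the origin.
    have hg : DifferentiableOn ℂ (fun z => f z * (starRingEnd ℂ a * P (z ^ N)
        - P 0 * starRingEnd ℂ b + (ρ : ℂ) ^ (2 * N) * dslope P 0 (z ^ N))) disc :=
      hf.mul (((hPN.const_mul _).sub_const _).add (hQN.const_mul _))
    have hm := circleAverage_of_differentiableOn hg h0 hlt
    simp only [zero_pow (show N ≠ 0 by omega), dslope_same] at hm
    rw [circleAverage_congr_sphere (f₂ := fun z => f z * (starRingEnd ℂ a * P (z ^ N)
        - P 0 * starRingEnd ℂ b + (ρ : ℂ) ^ (2 * N) * dslope P 0 (z ^ N))), hm]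
    · ring
    · intro z hz
      rw [abs_of_pos h0, mem_sphere_zero_iff_norm] at hz
      have hzz : z ^ N * starRingEnd ℂ z ^ N = (ρ : ℂ) ^ (2 * N) := by
        rw [← mul_pow, Complex.mul_conj, Complex.normSq_eq_norm_sq, hz, pow_mul]
        push_cast
        rfl
      have hs : z ^ N * dslope P 0 (z ^ N) = P (z ^ N) - P 0 := by
        simpa using sub_smul_dslope P 0 (z ^ N)
      simp only [Pi.sub_apply, map_add, map_pow]
      rw [← hzz]
      linear_combination (-f z * starRingEnd ℂ z ^ N) * hs

theorem integral_norm_pow_add_sq (hN : 1 ≤ N) (a : ℂ) :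
    ∫ z, ‖z ^ N + a‖ ^ 2 ∂area = ‖a‖ ^ 2 + 1 / ((N : ℝ) + 1) := by
  -- The cross term `2 Re (conj a z^N)` is replaced by the analytic `2 conj a z^N`, so that the mean
  -- value property applies on circles; the real part is taken at the end.
  set u : ℂ → ℂ := fun z => ((‖z‖ ^ (2 * N) : ℝ) : ℂ) + ((‖a‖ ^ 2 : ℝ) : ℂ)
    + 2 * starRingEnd ℂ a * z ^ N with hu
  have hui : Integrable u area := by
    refine integrable_of_continuousOn_of_bound (by rw [hu]; fun_prop)
      (1 + ‖a‖ ^ 2 + 2 * ‖a‖) fun z hz => ?_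
    have hz' : ‖z‖ ≤ 1 := (mem_disc.1 hz).le
    refine (norm_add₃_le).trans ?_
    simp only [Complex.norm_real, norm_mul, norm_pow, norm_norm, RCLike.norm_conj, Complex.norm_ofNat]
    have h1 := pow_le_one₀ (norm_nonneg z) hz' (n := 2 * N)
    have h2 := pow_le_one₀ (norm_nonneg z) hz' (n := N)
    have := mul_le_of_le_one_right (show 0 ≤ 2 * ‖a‖ by positivity) h2
    linarith
  have hint := integral_area_of_circleAverage hui (N := N) (A := ((‖a‖ ^ 2 : ℝ) : ℂ)) (B := 1) (by
    intro ρ h0 h1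
    have hg : DifferentiableOn ℂ (fun z : ℂ => ((ρ ^ (2 * N) : ℝ) : ℂ) + ((‖a‖ ^ 2 : ℝ) : ℂ)
      + 2 * starRingEnd ℂ a * z ^ N) disc := by fun_prop
    have hm := circleAverage_of_differentiableOn hg h0 h1
    rw [circleAverage_congr_sphere (f₂ := fun z : ℂ => ((ρ ^ (2 * N) : ℝ) : ℂ)
      + ((‖a‖ ^ 2 : ℝ) : ℂ) + 2 * starRingEnd ℂ a * z ^ N), hm, zero_pow (by omega)]
    · push_cast
      ring
    · intro z hz
      rw [abs_of_pos h0, mem_sphere_zero_iff_norm] at hz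
      simp only [hu, hz])
  have hre : ∀ z, ‖z ^ N + a‖ ^ 2 = (u z).re := by
    intro z
    have h : (starRingEnd ℂ a * z ^ N).re = (z ^ N * starRingEnd ℂ a).re := by rw [mul_comm]
    rw [Complex.sq_norm, Complex.normSq_add, Complex.normSq_eq_norm_sq, Complex.normSq_eq_norm_sq,
      norm_pow, ← pow_mul, mul_comm N 2]
    simp only [hu, Complex.add_re, Complex.ofReal_re, mul_assoc, ← h]
    rw [show (2 : ℂ) = ((2 : ℝ) : ℂ) by norm_num, Complex.re_ofReal_mul]
  simp_rw [hre]
  have h1 : (∫ z, (u z).re ∂area) = (∫ z, u z ∂area).re := integral_re hui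
  rw [h1, hint]
  have : ((‖a‖ ^ 2 : ℝ) : ℂ) + 1 / ((N : ℂ) + 1)
      = ((‖a‖ ^ 2 + 1 / ((N : ℝ) + 1) : ℝ) : ℂ) := by push_cast; rfl
  rw [this, Complex.ofReal_re]

end Bergman

/-! ### Powers of `z^N + a` and the extremal function. -/

namespace Bergman

open Real Set

variable {N : ℕ} {p : ℝ} {a b : ℂ} {L : ℂ → ℂ}

theorem IsLogBranch.norm_branchPow {g : ℂ → ℂ} (hL : IsLogBranch g L) (s : ℝ) {z : ℂ}
    (hz : z ∈ disc) : ‖branchPow L s z‖ = ‖g z‖ ^ s := by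
  rw [branchPow, ← hL.exp_eq z hz, Complex.norm_exp, Complex.norm_exp, Complex.re_ofReal_mul,
    ← Real.exp_mul, mul_comm]

theorem IsLogBranch.differentiableOn_branchPow {g : ℂ → ℂ} (hL : IsLogBranch g L) (s : ℝ) :
    DifferentiableOn ℂ (branchPow L s) disc :=
  (hL.analytic.const_mul _).cexp

theorem norm_sgn {w : ℂ} (hw : w ≠ 0) : ‖sgn w‖ = 1 := by
  rw [sgn, norm_div, Complex.norm_real, norm_norm, div_self (norm_ne_zero_iff.2 hw)]

theorem conj_sgn_mul {w : ℂ} (hw : w ≠ 0) : starRingEnd ℂ (sgn w) * w = (‖w‖ : ℂ) := by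
  have h : (‖w‖ : ℂ) ≠ 0 := by exact_mod_cast norm_ne_zero_iff.2 hw
  rw [sgn, map_div₀, Complex.conj_ofReal, div_mul_eq_mul_div, mul_comm, Complex.mul_conj,
    Complex.normSq_eq_norm_sq, div_eq_iff h]
  push_cast
  ring

theorem conj_sgn_mul_sgn {w : ℂ} (hw : w ≠ 0) : starRingEnd ℂ (sgn w) * sgn w = 1 := by
  rw [mul_comm, Complex.mul_conj, Complex.normSq_eq_norm_sq, norm_sgn hw]
  norm_num

/-- The functional with kernel `z ^ N + b` in terms of the power `(z ^ N + a) ^ s`. -/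
theorem integral_mul_branchPow (hN : 1 ≤ N) (ha : 1 ≤ ‖a‖) {s : ℝ} (hs : -1 < s)
    (hab : starRingEnd ℂ a + s / (a * ((N : ℂ) + 1)) = starRingEnd ℂ b)
    (hL : IsLogBranch (fun z => z ^ N + a) L) (hp : 1 < p) {f : ℂ → ℂ} (hf : MemBergman p f) :
    ∫ z, f z * (branchPow L s z * starRingEnd ℂ (z ^ N + a)) ∂area
      = branchPow L s 0 * functional (fun z => z ^ N + b) f := by
  have ha0 := ne_zero_of_one_le_norm ha
  set P : ℂ → ℂ := fun w => Complex.exp (s * (L 0 + Complex.log (1 + w / a))) with hPdef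
  have hP : DifferentiableOn ℂ P disc :=
    (((differentiableOn_log_one_add_div ha).const_add _).const_mul _).cexp
  have hP0 : P 0 = branchPow L s 0 := by simp [hPdef, branchPow]
  have hPd : deriv P 0 = P 0 * (s / a) := by
    have h1 : HasDerivAt (fun w : ℂ => 1 + w / a) (1 / a) 0 :=
      ((hasDerivAt_id (0 : ℂ)).div_const a).const_add 1
    have h2 := (((h1.clog (one_add_div_mem_slitPlane ha zero_mem_disc)).const_add
      (L 0)).const_mul (s : ℂ)).cexp
    rw [h2.deriv]
    simp only [hPdef]
    simp
    ring
  have hPz : ∀ z ∈ disc, P (z ^ N) = branchPow L s z := fun z hz => by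
    rw [branchPow, hL.eq_add_log hN ha hz]
  have hcongr : (fun z => f z * (branchPow L s z * starRingEnd ℂ (z ^ N + a))) =ᵐ[area]
      fun z => f z * (P (z ^ N) * starRingEnd ℂ (z ^ N + a)) :=
    ae_mem_disc.mono fun z hz => by simp only [hPz z hz]
  have hpow : ∀ z ∈ disc, ‖z ^ N‖ ≤ 1 := fun z hz => by
    rw [norm_pow]
    exact pow_le_one₀ (norm_nonneg _) (mem_disc.1 hz).le
  rw [integral_congr_ae hcongr, ← hP0, functional]
  refine integral_mul_comp_pow hN hf.analytic hP ?_ ?_ ?_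
  · rw [hPd, ← hab]
    have : (N : ℂ) + 1 ≠ 0 := by exact_mod_cast N.succ_ne_zero
    field_simp
  -- If `s < 0` and `|a| = 1`, the power alone is unbounded near the circle; the conjugate factor
  -- raises the exponent to `s + 1 > 0`.
  · refine (hf.integrable_mul_of_bound hp ?_ ((1 + ‖a‖) ^ (s + 1)) fun z hz => ?_).congr hcongr
    · exact (hL.differentiableOn_branchPow s).continuousOn.mul
        (Complex.continuous_conj.comp (by fun_prop)).continuousOn
    · have hne : 0 < ‖z ^ N + a‖ := by
        rw [norm_pos_iff, ← hL.exp_eq z hz]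
        exact Complex.exp_ne_zero _
      rw [norm_mul, hL.norm_branchPow s hz, RCLike.norm_conj, ← rpow_add_one hne.ne']
      refine rpow_le_rpow hne.le ((norm_add_le _ _).trans ?_) (by linarith)
      linarith [hpow z hz]
  · refine hf.integrable_mul_of_bound hp
      (Complex.continuous_conj.comp (by fun_prop)).continuousOn (1 + ‖b‖) fun z hz => ?_
    rw [RCLike.norm_conj]
    exact (norm_add_le _ _).trans (by linarith [hpow z hz])

theorem isExtremal_branchPow (hN : 1 ≤ N) (hp : 1 < p) (ha : 1 ≤ ‖a‖) (hb : b ≠ 0)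
    (hab : starRingEnd ℂ a + ((1 - 2 / p : ℝ) : ℂ) / (a * ((N : ℂ) + 1)) = starRingEnd ℂ b)
    (hL : IsLogBranch (fun z => z ^ N + a) L) {F : ℂ → ℂ}
    (hF : ∀ z ∈ disc, F z = sgn (branchPow L (1 - 2 / p) 0) * (branchPow L (2 / p) z /
      (((‖a‖ ^ 2 + 1 / ((N : ℝ) + 1)) ^ (1 / p) : ℝ) : ℂ))) :
    IsExtremal p (fun z => z ^ N + b) F ∧
      ∀ G, IsExtremal p (fun z => z ^ N + b) G → EqOn G F disc := by
  have hp0 : 0 < p := by linarith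
  set S : ℝ := ‖a‖ ^ 2 + 1 / ((N : ℝ) + 1) with hS
  have hS0 : 0 < S := by positivity
  set D : ℝ := S ^ (1 / p) with hD
  have hD0 : 0 < D := rpow_pos_of_pos hS0 _
  have hDp : D ^ p = S := by rw [hD, ← rpow_mul hS0.le, one_div_mul_cancel hp0.ne', rpow_one]
  set A : ℂ := branchPow L (1 - 2 / p) 0 with hA
  have hA0 : A ≠ 0 := Complex.exp_ne_zero _
  have hh0 : ∀ z ∈ disc, 0 < ‖z ^ N + a‖ := fun z hz => by
    rw [norm_pos_iff, ← hL.exp_eq z hz]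
    exact Complex.exp_ne_zero _
  have hhle : ∀ c : ℂ, ∀ z ∈ disc, ‖z ^ N + c‖ ≤ 1 + ‖c‖ := fun c z hz => by
    refine (norm_add_le _ _).trans (add_le_add_left ?_ _)
    rw [norm_pow]
    exact pow_le_one₀ (norm_nonneg _) (mem_disc.1 hz).le
  have hFn : ∀ z ∈ disc, ‖F z‖ = ‖z ^ N + a‖ ^ (2 / p) / D := fun z hz => by
    rw [hF z hz, norm_mul, norm_sgn hA0, one_mul, norm_div, hL.norm_branchPow _ hz,
      Complex.norm_real, norm_of_nonneg hD0.le]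
  have hFp : ∀ z ∈ disc, ‖F z‖ ^ p = ‖z ^ N + a‖ ^ 2 / S := fun z hz => by
    rw [hFn z hz, div_rpow (by positivity) hD0.le, hDp, ← rpow_mul (norm_nonneg _),
      div_mul_cancel₀ _ hp0.ne', rpow_two]
  have hFmem : MemBergman p F := by
    refine memBergman_of_bound hp0 (DifferentiableOn.congr
      (((hL.differentiableOn_branchPow (2 / p)).div_const _).const_mul _) hF)
      ((1 + ‖a‖) ^ (2 / p) / D) fun z hz => ?_
    rw [hFn z hz]
    gcongr
    exact hhle a z hz
  have hF1 : Bergman.norm p F = 1 := by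
    rw [norm_eq_one_iff hp, integral_congr_ae (ae_mem_disc.mono hFp), integral_div,
      integral_norm_pow_add_sq hN, div_self hS0.ne']
  have hpq : p.HolderConjugate (conjExponent p) := .conjExponent hp
  have hk : MemBergman (conjExponent p) (fun z => z ^ N + b) :=
    memBergman_of_bound hpq.symm.pos (by fun_prop) (1 + ‖b‖) (hhle b)
  have hk0 : ∃ z ∈ disc, z ^ N + b ≠ 0 :=
    ⟨0, zero_mem_disc, by rwa [zero_pow (by omega), zero_add]⟩
  -- `W` is `|F|^(p-2) conj F` written out, and `K` is forced by `conj (sgn A) * A = |A|`.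
  refine isExtremal_of_functional_eq (K := D ^ (p - 1) / ‖A‖)
    (W := fun z => starRingEnd ℂ (sgn A) * (branchPow L (1 - 2 / p) z *
      starRingEnd ℂ (z ^ N + a)) / ((D ^ (p - 1) : ℝ) : ℂ))
    hp hk hk0 hFmem hF1 (fun z hz => ?_) ?_ (fun z hz => ?_) (fun z hz => ?_) ?_ (fun f hf => ?_)
  · rw [← norm_pos_iff, hFn z hz]
    exact div_pos (rpow_pos_of_pos (hh0 z hz) _) hD0
  · exact (((hL.differentiableOn_branchPow _).continuousOn.mul
      (Complex.continuous_conj.comp (by fun_prop)).continuousOn).const_mul _).div_const _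
  · rw [norm_div, norm_mul, norm_mul, RCLike.norm_conj, RCLike.norm_conj, norm_sgn hA0, one_mul,
      Complex.norm_real, norm_of_nonneg (by positivity), hL.norm_branchPow _ hz,
      ← rpow_add_one (hh0 z hz).ne', hFn z hz, div_rpow (by positivity) hD0.le,
      ← rpow_mul (norm_nonneg _)]
    congr 2
    field_simp
    ring
  · have hexp : branchPow L (2 / p) z * branchPow L (1 - 2 / p) z = z ^ N + a := by
      rw [branchPow, branchPow, ← Complex.exp_add, ← hL.exp_eq z hz]
      congr 1
      push_cast
      ring
    have hDD : (D : ℂ) * ((D ^ (p - 1) : ℝ) : ℂ) = (S : ℂ) := by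
      rw [← Complex.ofReal_mul, mul_comm, ← rpow_add_one hD0.ne', sub_add_cancel, hDp]
    have hnn : (z ^ N + a) * starRingEnd ℂ (z ^ N + a) = ((‖z ^ N + a‖ ^ 2 : ℝ) : ℂ) := by
      rw [Complex.mul_conj, Complex.normSq_eq_norm_sq]
    rw [hFp z hz, hF z hz, Complex.ofReal_div, ← hnn, ← hDD]
    have e := conj_sgn_mul_sgn hA0
    calc _ = (starRingEnd ℂ (sgn A) * sgn A) * (branchPow L (2 / p) z * branchPow L (1 - 2 / p) z *
          starRingEnd ℂ (z ^ N + a)) / ((D : ℂ) * ((D ^ (p - 1) : ℝ) : ℂ)) := by ring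
      _ = _ := by rw [e, one_mul, hexp]
  · exact div_pos (rpow_pos_of_pos hD0 _) (norm_pos_iff.2 hA0)
  · have hs : -1 < 1 - 2 / p := by
      have : 2 / p < 2 := by rw [div_lt_iff₀ hp0]; linarith
      linarith
    have hint := integral_mul_branchPow hN ha hs hab hL hp hf
    have hE : ∀ z, f z * (starRingEnd ℂ (sgn A) * (branchPow L (1 - 2 / p) z *
        starRingEnd ℂ (z ^ N + a)) / ((D ^ (p - 1) : ℝ) : ℂ))
        = starRingEnd ℂ (sgn A) / ((D ^ (p - 1) : ℝ) : ℂ) *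
          (f z * (branchPow L (1 - 2 / p) z * starRingEnd ℂ (z ^ N + a))) := fun z => by ring
    simp_rw [hE]
    rw [integral_const_mul, hint, ← hA]
    have hn : (‖A‖ : ℂ) ≠ 0 := by exact_mod_cast norm_ne_zero_iff.2 hA0
    have hd : ((D ^ (p - 1) : ℝ) : ℂ) ≠ 0 := by exact_mod_cast (rpow_pos_of_pos hD0 _).ne'
    have e := conj_sgn_mul hA0
    rw [Complex.ofReal_div, div_mul_eq_mul_div, div_mul_eq_mul_div, ← mul_assoc, e]
    field_simp

/-- The larger root of `t ^ 2 - β t + c` when `1 + c ≤ β`. -/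
theorem larger_root_spec {β c : ℝ} (hβ : 1 + c ≤ β) {t : ℝ}
    (ht : t = (β + √(β ^ 2 - 4 * c)) / 2) : 1 ≤ t ∧ t + c / t = β := by
  -- Equivalent to `1 + c ≤ β`; it gives both a nonnegative discriminant and `t ≥ 1`.
  have hdisc : (2 - β) ^ 2 ≤ β ^ 2 - 4 * c := by nlinarith
  have hle : 2 - β ≤ √(β ^ 2 - 4 * c) := le_sqrt_of_sq_le hdisc
  have h1 : 1 ≤ t := by linarith
  have hsq := sq_sqrt ((sq_nonneg _).trans hdisc)
  have hs : √(β ^ 2 - 4 * c) = 2 * t - β := by linarith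
  rw [hs] at hsq
  refine ⟨h1, ?_⟩
  have : t ≠ 0 := by linarith
  field_simp
  linarith

end Bergman

/-! ### The choice of `a`. -/

theorem mainTheorem5 (N : ℕ) (hN : 1 ≤ N) (p : ℝ) (hp : 1 < p) (b a : ℂ)
    (hb : 1 + 1 / ((N : ℝ) + 1) * (1 - 2 / p) ≤ ‖b‖)
    (ha : a = (((‖b‖ + Real.sqrt (‖b‖ ^ 2 - 4 / ((N : ℝ) + 1) * (1 - 2 / p))) / 2 : ℝ) : ℂ)
      * Bergman.sgn b) :
    (∃ L : ℂ → ℂ, Bergman.IsLogBranch (fun z => z ^ N + a) L) ∧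
    ∀ L : ℂ → ℂ, Bergman.IsLogBranch (fun z => z ^ N + a) L →
      ∀ F : ℂ → ℂ,
        (∀ z ∈ Bergman.disc,
          F z = Bergman.sgn (Bergman.branchPow L (1 - 2 / p) 0) *
            (Bergman.branchPow L (2 / p) z /
              (((‖a‖ ^ 2 + 1 / ((N : ℝ) + 1)) ^ (1 / p) : ℝ) : ℂ))) →
        Bergman.IsExtremal p (fun z => z ^ N + b) F ∧
        ∀ G : ℂ → ℂ, Bergman.IsExtremal p (fun z => z ^ N + b) G →
          Set.EqOn G F Bergman.disc := by
  have hp0 : 0 < p := by linarith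
  set c : ℝ := 1 / ((N : ℝ) + 1) * (1 - 2 / p) with hc
  have hNpos : (0 : ℝ) < (N : ℝ) + 1 := by positivity
  have hN1 : 1 / ((N : ℝ) + 1) ≤ 1 := by
    rw [div_le_one hNpos]
    linarith [(Nat.cast_nonneg N : (0 : ℝ) ≤ N)]
  have hs2 : -1 < 1 - 2 / p := by
    have : 2 / p < 2 := by rw [div_lt_iff₀ hp0]; linarith
    linarith
  have hinv : 0 < 1 / ((N : ℝ) + 1) := by positivity
  -- Makes the lower bound `1 + c` for `|b|` positive, hence `b ≠ 0`.
  have hc2 : -1 < c := by nlinarith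
  have hb0 : b ≠ 0 := by rw [← norm_pos_iff]; linarith
  obtain ⟨ht1, ht⟩ := Bergman.larger_root_spec hb rfl
  rw [show 4 / ((N : ℝ) + 1) * (1 - 2 / p) = 4 * c by rw [hc]; ring] at ha
  set t : ℝ := (‖b‖ + √(‖b‖ ^ 2 - 4 * c)) / 2
  have hu : ‖Bergman.sgn b‖ = 1 := Bergman.norm_sgn hb0
  have ha1 : 1 ≤ ‖a‖ := by
    rw [ha, norm_mul, hu, mul_one, Complex.norm_real, Real.norm_of_nonneg (by linarith)]
    exact ht1
  -- As `1 / sgn b = conj (sgn b)`, this is `t + c/t = |b|` multiplied by `conj (sgn b)`.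
  have hab : starRingEnd ℂ a + ((1 - 2 / p : ℝ) : ℂ) / (a * ((N : ℂ) + 1)) = starRingEnd ℂ b := by
    have h1 := Bergman.conj_sgn_mul_sgn hb0
    have h2 : (t : ℂ) + (c : ℂ) / t = (‖b‖ : ℂ) := by exact_mod_cast ht
    have hbn : starRingEnd ℂ b = (‖b‖ : ℂ) * starRingEnd ℂ (Bergman.sgn b) := by
      have hn : (‖b‖ : ℂ) ≠ 0 := by exact_mod_cast norm_ne_zero_iff.2 hb0
      rw [Bergman.sgn, map_div₀, Complex.conj_ofReal, mul_div_cancel₀ _ hn]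
    have hcc : ((1 - 2 / p : ℝ) : ℂ) / (a * ((N : ℂ) + 1)) = (c : ℂ) / a := by
      rw [hc, mul_comm a, div_mul_eq_div_div]
      push_cast
      ring
    have hui : (Bergman.sgn b)⁻¹ = starRingEnd ℂ (Bergman.sgn b) :=
      (eq_inv_of_mul_eq_one_left h1).symm
    rw [hcc, ha, hbn, ← h2, map_mul, Complex.conj_ofReal, div_mul_eq_div_div, div_eq_mul_inv _
      (Bergman.sgn b), hui]
    ring
  refine ⟨⟨_, Bergman.isLogBranch_log hN ha1
    (Complex.exp_log (Bergman.ne_zero_of_one_le_norm ha1))⟩, fun L hL F hF => ?_⟩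
  exact Bergman.isExtremal_branchPow hN hp ha1 hb0 hab hL hF
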